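/- For $S\subseteq\mathbb{R}$, an integer $n\ge 0$ and a real $d>0$, let $G(S^n,d)$ be the graph with vertex set $S^n$ in which two points are adjacent if and only if their Euclidean distance is $d$ (so $\mathbb{R}^0$ is a single point and $G(\mathbb{R}^0,1)$ is a single vertex). A graph $G$ is called a subgraph of a graph $G'$ if $G$ is isomorphic to a (not necessarily induced) subgraph of $G'$. A real number $d>0$ is realized in $\mathbb{Q}^n$ if it is the Euclidean distance between two points of $\mathbb{Q}^n$. $C_4$ is the cycle on four vertices and $K_{m_1,\dots,m_k}$ is the complete $k$-partite graph with parts of sizes $m_1,\dots,m_k$. For every integer $n$ with $1\le n\le 5$ and every $d>0$ realized in $\mathbb{Q}^n$, there is a finite subgraph of $G(\mathbb{Q}^n,d)$ that is not a subgraph of $G(\mathbb{R}^{n-1},1)$. For $2\le n\le 5$ a single graph works for all such $d$: (a) $C_4$ is a subgraph of $G(\mathbb{Q}^2,d)$ for every $d>0$ realized in $\mathbb{Q}^2$, and is not a subgraph of $G(\mathbb{R}^1,1)$; (b) $K_{2,3}$ is a subgraph of $G(\mathbb{Q}^3,d)$ for every $d>0$ realized in $\mathbb{Q}^3$, and is not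 a subgraph of $G(\mathbb{R}^2,1)$; (c) $K_{1,1,1,3}$ is a subgraph of $G(\mathbb{Q}^4,d)$ for every $d>0$ realized in $\mathbb{Q}^4$, and is not a subgraph of $G(\mathbb{R}^3,1)$; (d) $K_{1,3,3}$ is a subgraph of $G(\mathbb{Q}^5,d)$ for every $d>0$ realized in $\mathbb{Q}^5$, and is not a subgraph of $G(\mathbb{R}^4,1)$. -/

import Mathlib

namespace EuclideanDistanceGraph

/-- The points of `S^n`, as a subset of Euclidean `n`-space. For `n = 0` there is exactly one. -/
def points (S : Set ℝ) (n : ℕ) : Set (EuclideanSpace ℝ (Fin n)) :=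
  {x | ∀ i, x i ∈ S}

/-- The Euclidean distance graph `G(S^n, d)`: vertex set `S^n`, two vertices being adjacent iff they
are at Euclidean distance `d`. It is used for `d > 0` only, where the clause `x ≠ y`
(needed for a loopless graph when `d = 0`) is automatic. -/
def distGraph (S : Set ℝ) (n : ℕ) (d : ℝ) : SimpleGraph (points S n) where
  Adj x y := x ≠ y ∧ dist x y = d
  symm := ⟨fun x y h => ⟨h.1.symm, by rw [dist_comm]; exact h.2⟩⟩
  loopless := ⟨fun _ h => h.1 rfl⟩

/-- The rational numbers as a set of real numbers. -/
def rationals : Set ℝ := Set.range ((↑) : ℚ → ℝ)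

/-- `G(ℚ^n, d)`. -/
abbrev ratGraph (n : ℕ) (d : ℝ) : SimpleGraph (points rationals n) :=
  distGraph rationals n d

/-- `G(ℝ^n, 1)`. -/
abbrev unitDistGraph (n : ℕ) : SimpleGraph (points Set.univ n) :=
  distGraph Set.univ n 1

/-- `d > 0` is a distance realized between points of `ℚ^n`. -/
def RealizedInRat (n : ℕ) (d : ℝ) : Prop :=
  0 < d ∧ ∃ x ∈ points rationals n, ∃ y ∈ points rationals n, dist x y = d

/-- The complete multipartite graph whose parts have the sizes `p 0, …, p (k - 1)`. -/
abbrev multipartite {k : ℕ} (p : Fin k → ℕ) : SimpleGraph (Σ i, Fin (p i)) :=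
  SimpleGraph.completeMultipartiteGraph fun i => Fin (p i)

end EuclideanDistanceGraph

/-!
The two halves of the theorem rest on different facts.

*Graphs that do not embed in `ℝ^(n-1)`.* If every point of a family `A` is at the same distance
from every point of a family `B`, then the directions of the affine spans of `A` and `B` are
orthogonal, so affinely independent families of `k + 1` and `l + 1` points of this kind force
`k + l ≤ dim` (`add_le_finrank_of_dist_eq`). Three distinct points of a sphere are affinely
independent, which makes this bound decisive for `C₄`, `K_{2,3}` and `K_{1,1,1,3}`; in the last
case the three singletons form the family `A`. For `K_{1,3,3}` the apex is added to one of the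
parts of size three: the four points are affinely independent, since the affine span of that part
lies in the perpendicular bisector of the apex and a vertex of the other part. For `n = 1` a single
edge is not contained in the graph on the one point of `ℝ^0`.

*Embeddings into `ℚ^n`.* Put `r = d^2`. In the plane there is a square with side vector `(a, b)`,
where `a ^ 2 + b ^ 2 = r`. In `ℚ^3`, after writing `r = a ^ 2 + b ^ 2 + c ^ 2` with `a, b ≠ 0`, the
points `0` and `(2a, 0, 0)` have the common neighbours obtained from `(a, b, c)` by quarter turns
about the first axis. In `ℚ^4`, a sum of four rational squares `r` is the norm of a quaternion, and
multiplication by it scales distances by `√r`, so it is enough to treat `r = 1`. In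
`ℚ^5 = ℚ × ℚ^4` the same similarity on the second factor changes the quadratic form to
`y ^ 2 + r * |x| ^ 2`. With `e` the first basis vector of `ℚ^4`, the apex is `0`, one part is
`(9/10) e + u` with `|u| ^ 2 = 19/100` and `u` in a plane `U`, and the other is `(5/9) e + w` with
`w` in the span of a vector `w₀ ⟂ U` and of the additional axis. The condition for adjacency is
`9/10 * 5/9 = 1/2`, and two points of either part are `±u` and `±w₀`. The third point of the first
part is a further rational point of the circle in `U`, and that of the second is found on the
conic `N * x ^ 2 + y ^ 2 = N`, which has the rational point `(1, 0)`, whatever `N` is.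
-/

namespace EuclideanDistanceGraph

open SimpleGraph Module

/-! ### Orthogonal families at a common distance -/

section NonEmbedding

variable {E : Type*} [NormedAddCommGroup E] [InnerProductSpace ℝ E]

theorem vectorSpan_isOrtho_vectorSpan {ι κ : Type*} {A : ι → E} {B : κ → E} {r : ℝ}
    (h : ∀ i j, dist (A i) (B j) = r) :
    vectorSpan ℝ (Set.range A) ⟂ vectorSpan ℝ (Set.range B) := by
  refine Submodule.isOrtho_span.2 ?_
  rintro _ ⟨_, ⟨i, rfl⟩, _, ⟨i', rfl⟩, rfl⟩ _ ⟨_, ⟨j, rfl⟩, _, ⟨j', rfl⟩, rfl⟩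
  refine EuclideanGeometry.inner_vsub_vsub_of_dist_eq_of_dist_eq ?_ ?_ <;>
    simp only [dist_comm (B _), h]

/-- Affinely independent families at a constant distance from each other span orthogonal
directions, of dimensions `k` and `l`. -/
theorem add_le_finrank_of_dist_eq [FiniteDimensional ℝ E] {k l : ℕ} {A : Fin (k + 1) → E}
    {B : Fin (l + 1) → E} (hA : AffineIndependent ℝ A) (hB : AffineIndependent ℝ B) {r : ℝ}
    (h : ∀ i j, dist (A i) (B j) = r) : k + l ≤ finrank ℝ E := by
  rw [← hA.finrank_vectorSpan (Fintype.card_fin _), ← hB.finrank_vectorSpan (Fintype.card_fin _)]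
  exact Submodule.finrank_add_finrank_le_of_disjoint (vectorSpan_isOrtho_vectorSpan h).disjoint

/-- Three distinct points of a sphere are not collinear. -/
theorem affineIndependent_of_dist_eq {A : Fin 3 → E} (hA : Function.Injective A) {c : E} {r : ℝ}
    (h : ∀ i, dist (A i) c = r) : AffineIndependent ℝ A :=
  EuclideanGeometry.Cospherical.affineIndependent (s := Set.range A)
    ⟨c, r, by rintro _ ⟨i, rfl⟩; exact h i⟩ subset_rfl hA

/-- Adding a point outside the affine span to an affinely independent family keeps it so. -/
theorem affineIndependent_cons {n : ℕ} {A : Fin n → E} (hA : AffineIndependent ℝ A) {o : E}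
    (ho : o ∉ affineSpan ℝ (Set.range A)) :
    AffineIndependent ℝ (Fin.cons o A : Fin (n + 1) → E) := by
  refine AffineIndependent.affineIndependent_of_notMem_span (i := 0) ?_ ?_
  · rw [← affineIndependent_equiv (finSuccAboveEquiv (0 : Fin (n + 1)))]
    convert! hA
  · refine fun hmem => ho (affineSpan_mono ℝ ?_ hmem)
    rintro _ ⟨i, hi, rfl⟩
    obtain ⟨j, rfl⟩ := Fin.exists_succ_eq.2 hi
    exact ⟨j, rfl⟩

/-- The affine span of points equidistant from `o` and `b` lies in the perpendicular bisector of
`o` and `b`, which does not contain `o`. -/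
theorem notMem_affineSpan_of_dist_eq {ι : Type*} {A : ι → E} {o b : E} (hob : o ≠ b) {r : ℝ}
    (ho : ∀ i, dist (A i) o = r) (hb : ∀ i, dist (A i) b = r) :
    o ∉ affineSpan ℝ (Set.range A) := by
  intro h
  have hle : affineSpan ℝ (Set.range A) ≤ AffineSubspace.perpBisector o b := by
    rw [affineSpan_le]
    rintro _ ⟨i, rfl⟩
    exact AffineSubspace.mem_perpBisector_iff_dist_eq.2 ((ho i).trans (hb i).symm)
  exact hob (AffineSubspace.left_mem_perpBisector.1 (hle h))

end NonEmbedding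

/-! ### Graphs that do not embed in the unit distance graph -/

variable {S : Set ℝ} {n : ℕ} {d : ℝ}

theorem injective_coe_copy {V : Type*} {G : SimpleGraph V} (f : Copy G (distGraph S n d)) :
    Function.Injective fun v => (f v : EuclideanSpace ℝ (Fin n)) :=
  Subtype.val_injective.comp f.injective

theorem dist_coe_copy {V : Type*} {G : SimpleGraph V} (f : Copy G (distGraph S n d)) {v w : V}
    (h : G.Adj v w) : dist (f v : EuclideanSpace ℝ (Fin n)) (f w) = d :=
  (f.toHom.map_rel h).2

theorem not_cycleGraph_four_isContained : ¬ (cycleGraph 4).IsContained (unitDistGraph 1) := by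
  rintro ⟨f⟩
  have hf := injective_coe_copy f
  have h := add_le_finrank_of_dist_eq (k := 1) (l := 1) (r := 1)
    (affineIndependent_of_ne ℝ (hf.ne (show (0 : Fin 4) ≠ 2 by decide)))
    (affineIndependent_of_ne ℝ (hf.ne (show (1 : Fin 4) ≠ 3 by decide)))
    (fun i j => by
      fin_cases i <;> fin_cases j <;> exact dist_coe_copy f (by rw [cycleGraph_adj]; decide))
  simp at h

theorem not_multipartite_two_three_isContained :
    ¬ (multipartite ![2, 3]).IsContained (unitDistGraph 2) := by
  rintro ⟨f⟩
  have hf := injective_coe_copy f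
  let A : Fin 2 → EuclideanSpace ℝ (Fin 2) := fun i => f ⟨0, i⟩
  let B : Fin 3 → EuclideanSpace ℝ (Fin 2) := fun i => f ⟨1, i⟩
  have hAB : ∀ i j, dist (A i) (B j) = 1 := fun i j =>
    dist_coe_copy f (show (0 : Fin 2) ≠ 1 by decide)
  have hA : AffineIndependent ℝ A := by
    convert! affineIndependent_of_ne ℝ
      (p₁ := A 0) (p₂ := A 1) (hf.ne (sigma_mk_injective.ne (show (0 : Fin 2) ≠ 1 by decide)))
    ext i; fin_cases i <;> rfl
  have hB : AffineIndependent ℝ B := affineIndependent_of_dist_eq (c := A 0) (r := 1)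
    (hf.comp sigma_mk_injective) (fun i => by rw [_root_.dist_comm, hAB])
  simpa using add_le_finrank_of_dist_eq hA hB hAB

theorem not_multipartite_one_one_one_three_isContained :
    ¬ (multipartite ![1, 1, 1, 3]).IsContained (unitDistGraph 3) := by
  rintro ⟨f⟩
  have hf := injective_coe_copy f
  -- the three singleton parts
  let a : Fin 3 → Σ i, Fin (![1, 1, 1, 3] i) :=
    ![⟨0, (0 : Fin 1)⟩, ⟨1, (0 : Fin 1)⟩, ⟨2, (0 : Fin 1)⟩]
  let A : Fin 3 → EuclideanSpace ℝ (Fin 3) := fun i => f (a i)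
  let B : Fin 3 → EuclideanSpace ℝ (Fin 3) := fun i => f ⟨3, i⟩
  have ha : Function.Injective a := by decide
  have hAB : ∀ i j, dist (A i) (B j) = 1 := fun i j =>
    dist_coe_copy f (show (a i).1 ≠ 3 by fin_cases i <;> decide)
  have hA : AffineIndependent ℝ A := affineIndependent_of_dist_eq (c := B 0) (r := 1)
    (hf.comp ha) (fun i => hAB i 0)
  have hB : AffineIndependent ℝ B := affineIndependent_of_dist_eq (c := A 0) (r := 1)
    (hf.comp sigma_mk_injective) (fun i => by rw [_root_.dist_comm, hAB])
  simpa using add_le_finrank_of_dist_eq hA hB hAB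

theorem not_multipartite_one_three_three_isContained :
    ¬ (multipartite ![1, 3, 3]).IsContained (unitDistGraph 4) := by
  rintro ⟨f⟩
  have hf := injective_coe_copy f
  let o : EuclideanSpace ℝ (Fin 4) := f ⟨0, (0 : Fin 1)⟩
  let A : Fin 3 → EuclideanSpace ℝ (Fin 4) := fun i => f ⟨1, i⟩
  let B : Fin 3 → EuclideanSpace ℝ (Fin 4) := fun i => f ⟨2, i⟩
  have hAB : ∀ i j, dist (A i) (B j) = 1 := fun i j =>
    dist_coe_copy f (show (1 : Fin 3) ≠ 2 by decide)
  have hAo : ∀ i, dist (A i) o = 1 := fun i => dist_coe_copy f (show (1 : Fin 3) ≠ 0 by decide)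
  have hoB : ∀ j, dist o (B j) = 1 := fun i => dist_coe_copy f (show (0 : Fin 3) ≠ 2 by decide)
  have hA : AffineIndependent ℝ A := affineIndependent_of_dist_eq (hf.comp sigma_mk_injective) hAo
  have hB : AffineIndependent ℝ B := affineIndependent_of_dist_eq (c := o) (r := 1)
    (hf.comp sigma_mk_injective) (fun i => by rw [_root_.dist_comm, hoB])
  -- the apex `o` is outside the plane of `A`, so `o` and `A` together span three dimensions
  have hob : o ≠ B 0 := dist_ne_zero.1 (by rw [hoB]; exact one_ne_zero)
  have ho := notMem_affineSpan_of_dist_eq hob hAo fun i => hAB i 0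
  have h := add_le_finrank_of_dist_eq (r := 1) (affineIndependent_cons hA ho) hB
    (Fin.cases hoB hAB)
  simp at h

/-! ### Rational points -/

/-- A rational vector, viewed as a point of `ℚ^n` inside Euclidean `n`-space. -/
def ratPoint {n : ℕ} (q : Fin n → ℚ) : points rationals n :=
  ⟨WithLp.toLp 2 fun i => (q i : ℝ), fun i => ⟨q i, rfl⟩⟩

theorem dist_ratPoint_sq (p q : Fin n → ℚ) :
    dist (ratPoint p) (ratPoint q) ^ 2 = ((∑ i, (p i - q i) ^ 2 : ℚ) : ℝ) := by
  rw [Subtype.dist_eq, EuclideanSpace.dist_eq, Real.sq_sqrt (by positivity)]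
  simp [ratPoint, Real.dist_eq, sq_abs]

theorem ratPoint_injective : Function.Injective (ratPoint (n := n)) := by
  intro p q h
  ext i
  have : (p i : ℝ) = q i :=
    congrArg (fun x : points rationals n => (x : EuclideanSpace ℝ (Fin n)) i) h
  exact_mod_cast this

/-- The square of a distance realized in `ℚ^n` is a positive sum of `n` rational squares. -/
theorem RealizedInRat.exists_sum_sq (h : RealizedInRat n d) :
    ∃ v : Fin n → ℚ, ((∑ i, v i ^ 2 : ℚ) : ℝ) = d ^ 2 ∧ 0 < ∑ i, v i ^ 2 := by
  obtain ⟨hd, x, hx, y, hy, rfl⟩ := h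
  choose p hp using hx
  choose q hq using hy
  have key : ((∑ i, (p i - q i) ^ 2 : ℚ) : ℝ) = dist x y ^ 2 := by
    rw [← dist_ratPoint_sq, Subtype.dist_eq]
    congr 2 <;> ext i
    exacts [hp i, hq i]
  refine ⟨p - q, key, ?_⟩
  have : (0 : ℝ) < ((∑ i, (p i - q i) ^ 2 : ℚ) : ℝ) := key ▸ pow_pos hd 2
  exact_mod_cast this

/-- To embed a graph in `G(ℚ^n, d)` it is enough to give rational coordinates whose squared
distances along the edges are the rational number `R = d ^ 2`. -/
theorem isContained_ratGraph {V : Type*} {G : SimpleGraph V} (hd : 0 < d) {R : ℚ}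
    (hR : (R : ℝ) = d ^ 2) (f : V → Fin n → ℚ) (hf : Function.Injective f)
    (h : ∀ v w, G.Adj v w → ∑ i, (f v i - f w i) ^ 2 = R) : G.IsContained (ratGraph n d) := by
  refine ⟨⟨⟨fun v => ratPoint (f v), fun {v w} hvw => ⟨?_, ?_⟩⟩, ratPoint_injective.comp hf⟩⟩
  · exact (ratPoint_injective.comp hf).ne hvw.ne
  · refine (pow_left_inj₀ dist_nonneg hd.le two_ne_zero).1 ?_
    rw [dist_ratPoint_sq, h v w hvw, hR]

/-- For a complete multipartite graph, injectivity has to be checked within each part only, since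
vertices in different parts are at the positive distance `d`. -/
theorem multipartite_isContained_ratGraph {k : ℕ} {p : Fin k → ℕ} (hd : 0 < d) {R : ℚ}
    (hR : (R : ℝ) = d ^ 2) (g : ∀ i, Fin (p i) → Fin n → ℚ) (hg : ∀ i, Function.Injective (g i))
    (h : ∀ i j, i < j → ∀ a b, ∑ m, (g i a m - g j b m) ^ 2 = R) :
    (multipartite p).IsContained (ratGraph n d) := by
  have hR0 : R ≠ 0 := by
    rintro rfl
    exact (pow_pos hd 2).ne (by simpa using hR)
  have h' : ∀ i j, i ≠ j → ∀ a b, ∑ m, (g i a m - g j b m) ^ 2 = R := by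
    intro i j hij a b
    rcases hij.lt_or_gt with hlt | hlt
    · exact h i j hlt a b
    · simpa only [sub_sq_comm (g i a _)] using h j i hlt b a
  refine isContained_ratGraph hd hR (fun v => g v.1 v.2) ?_ fun v w hvw => h' _ _ hvw _ _
  rintro ⟨i, a⟩ ⟨j, b⟩ hab
  obtain rfl | hij := eq_or_ne i j
  · exact congrArg (Sigma.mk i) (hg i hab)
  · exact absurd (by simpa [hab] using (h' i j hij a b).symm) hR0

theorem injective_vec_two {α : Type*} {a b : α} (hab : a ≠ b) :
    Function.Injective ![a, b] := by
  intro i j h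
  fin_cases i <;> fin_cases j <;> simp_all

theorem injective_vec_three {α : Type*} {a b c : α} (hab : a ≠ b) (hac : a ≠ c) (hbc : b ≠ c) :
    Function.Injective ![a, b, c] := by
  intro i j h
  fin_cases i <;> fin_cases j <;> simp_all

/-! ### The configurations in dimensions two and three -/

theorem cycleGraph_four_isContained (h : RealizedInRat 2 d) :
    (cycleGraph 4).IsContained (ratGraph 2 d) := by
  obtain ⟨v, hv, hpos⟩ := h.exists_sum_sq
  rw [Fin.sum_univ_two] at hv hpos
  set a := v 0
  set b := v 1
  refine isContained_ratGraph h.1 hv ![![0, 0], ![a, b], ![a - b, b + a], ![-b, a]] ?_ ?_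
  · intro i j hij
    have h0 := congrFun hij 0
    have h1 := congrFun hij 1
    fin_cases i <;> fin_cases j <;> simp at h0 h1 ⊢ <;> nlinarith
  · intro i j hij
    rw [cycleGraph_adj] at hij
    fin_cases i <;> fin_cases j <;> first
      | exact absurd hij (by decide)
      | (simp [Fin.sum_univ_two]; try ring)

/-- A sum of three rational squares can be rewritten with two nonzero terms; a single square uses
`1 = (2/3)^2 + (2/3)^2 + (1/3)^2`. -/
theorem exists_sum_three_sq_of_pos {x y z : ℚ} (h : 0 < x ^ 2 + y ^ 2 + z ^ 2) :
    ∃ a b c : ℚ, a ≠ 0 ∧ b ≠ 0 ∧ a ^ 2 + b ^ 2 + c ^ 2 = x ^ 2 + y ^ 2 + z ^ 2 := by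
  by_cases hx : x = 0
  · by_cases hy : y = 0
    · have hz : z ≠ 0 := by rintro rfl; simp [hx, hy] at h
      exact ⟨2 * z / 3, 2 * z / 3, z / 3, by simpa, by simpa, by rw [hx, hy]; ring⟩
    · by_cases hz : z = 0
      · exact ⟨2 * y / 3, 2 * y / 3, y / 3, by simpa, by simpa, by rw [hx, hz]; ring⟩
      · exact ⟨y, z, x, hy, hz, by ring⟩
  · by_cases hy : y = 0
    · by_cases hz : z = 0
      · exact ⟨2 * x / 3, 2 * x / 3, x / 3, by simpa, by simpa, by rw [hy, hz]; ring⟩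
      · exact ⟨x, z, y, hx, hz, by ring⟩
    · exact ⟨x, y, z, hx, hy, rfl⟩

theorem multipartite_two_three_isContained (h : RealizedInRat 3 d) :
    (multipartite ![2, 3]).IsContained (ratGraph 3 d) := by
  obtain ⟨v, hv, hpos⟩ := h.exists_sum_sq
  rw [Fin.sum_univ_three] at hv hpos
  obtain ⟨a, b, c, ha, hb, habc⟩ := exists_sum_three_sq_of_pos hpos
  rw [← habc] at hv
  -- the second part consists of `(a, b, c)` and its rotations by a half and a quarter turn about
  -- the first axis
  let g : ∀ i, Fin (![2, 3] i) → Fin 3 → ℚ := fun i => match i with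
    | 0 => (![![0, 0, 0], ![2 * a, 0, 0]] : Fin 2 → Fin 3 → ℚ)
    | 1 => (![![a, b, c], ![a, -b, -c], ![a, -c, b]] : Fin 3 → Fin 3 → ℚ)
  refine multipartite_isContained_ratGraph h.1 hv g ?_ ?_
  · intro i
    fin_cases i
    · exact injective_vec_two fun h => ha (by simpa using (congrFun h 0).symm)
    · have hbb := pow_pos (abs_pos.2 hb) 2
      rw [sq_abs] at hbb
      refine injective_vec_three ?_ ?_ ?_ <;> intro h <;>
        have h1 := congrFun h 1 <;> have h2 := congrFun h 2 <;> simp at h1 h2 <;> nlinarith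
  · intro i j hij s t
    fin_cases i <;> fin_cases j <;> try exact absurd hij (by decide)
    revert s t
    change ∀ s : Fin 2, ∀ t : Fin 3, _
    intro s t
    fin_cases s <;> fin_cases t <;> simp [g, Fin.sum_univ_three] <;> ring

/-! ### The configurations in dimensions four and five -/

/-- Lagrange's four square theorem for rational numbers, from `p / q = p * q / q ^ 2`. -/
theorem exists_sum_four_sq {r : ℚ} (hr : 0 ≤ r) :
    ∃ a b c e : ℚ, a ^ 2 + b ^ 2 + c ^ 2 + e ^ 2 = r := by
  obtain ⟨a, b, c, e, h⟩ := Nat.sum_four_squares (r.num.toNat * r.den)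
  have hden : (r.den : ℚ) ≠ 0 := by exact_mod_cast r.den_nz
  have hnum : ((r.num.toNat : ℕ) : ℚ) = r.num := by
    exact_mod_cast Int.toNat_of_nonneg (Rat.num_nonneg.2 hr)
  have h' : (a ^ 2 + b ^ 2 + c ^ 2 + e ^ 2 : ℚ) = r.num * r.den := by
    rw [← hnum]; exact_mod_cast h
  refine ⟨a / r.den, b / r.den, c / r.den, e / r.den, ?_⟩
  calc _ = (a ^ 2 + b ^ 2 + c ^ 2 + e ^ 2 : ℚ) / (r.den * r.den) := by field_simp
    _ = r.num / r.den := by rw [h']; field_simp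
    _ = r := r.num_div_den

/-- Multiplication by a quaternion of norm `r` is a rational similarity of `ℚ^4` that multiplies
squared distances by `r`. -/
theorem exists_similarity {r : ℚ} (hr : 0 < r) :
    ∃ φ : (Fin 4 → ℚ) → Fin 4 → ℚ, Function.Injective φ ∧
      ∀ x y, ∑ i, (φ x i - φ y i) ^ 2 = r * ∑ i, (x i - y i) ^ 2 := by
  obtain ⟨a, b, c, e, rfl⟩ := exists_sum_four_sq hr.le
  have key : ∃ φ : (Fin 4 → ℚ) → Fin 4 → ℚ, ∀ x y, ∑ i, (φ x i - φ y i) ^ 2 =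
      (a ^ 2 + b ^ 2 + c ^ 2 + e ^ 2) * ∑ i, (x i - y i) ^ 2 := by
    -- the coordinates of `(a + b i + c j + e k) * (x 0 + x 1 i + x 2 j + x 3 k)`
    refine ⟨fun x => ![a * x 0 - b * x 1 - c * x 2 - e * x 3, a * x 1 + b * x 0 + c * x 3 - e * x 2,
      a * x 2 - b * x 3 + c * x 0 + e * x 1, a * x 3 + b * x 2 - c * x 1 + e * x 0],
      fun x y => ?_⟩
    simp only [Fin.sum_univ_four, Matrix.cons_val]
    ring
  obtain ⟨φ, hφ⟩ := key
  refine ⟨φ, fun x y hxy => ?_, hφ⟩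
  have h0 : ∑ i, (x i - y i) ^ 2 = 0 := by
    have := hφ x y
    simp only [hxy, sub_self, ne_eq, OfNat.ofNat_ne_zero, not_false_eq_true, zero_pow,
      Finset.sum_const_zero] at this
    exact (mul_eq_zero.1 this.symm).resolve_left hr.ne'
  ext i
  have := (Finset.sum_eq_zero_iff_of_nonneg fun i _ => sq_nonneg (x i - y i)).1 h0 i
    (Finset.mem_univ i)
  exact sub_eq_zero.1 (pow_eq_zero_iff two_ne_zero |>.1 this)

theorem multipartite_one_one_one_three_isContained (h : RealizedInRat 4 d) :
    (multipartite ![1, 1, 1, 3]).IsContained (ratGraph 4 d) := by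
  obtain ⟨v, hv, hpos⟩ := h.exists_sum_sq
  obtain ⟨φ, hφinj, hφ⟩ := exists_similarity hpos
  -- a configuration with unit distances, to be scaled by `φ`
  let g : ∀ i, Fin (![1, 1, 1, 3] i) → Fin 4 → ℚ := fun i => match i with
    | 0 => fun _ => ![0, 0, 0, 0]
    | 1 => fun _ => ![1, 0, 0, 0]
    | 2 => fun _ => ![1/2, 1/2, 1/2, 1/2]
    | 3 => (![![1/2, -1/2, 1/2, 1/2], ![1/2, 1/2, -1/2, 1/2], ![1/2, 1/2, 1/2, -1/2]] :
        Fin 3 → Fin 4 → ℚ)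
  refine multipartite_isContained_ratGraph h.1 hv (fun i a => φ (g i a)) ?_ ?_
  · intro i
    refine hφinj.comp ?_
    have hss : ∀ j : Fin 1 → Fin 4 → ℚ, Function.Injective j := fun j =>
      Function.injective_of_subsingleton j
    fin_cases i
    · exact hss _
    · exact hss _
    · exact hss _
    · exact injective_vec_three
        (fun h => absurd (congrFun h 1) (by norm_num)) (fun h => absurd (congrFun h 1) (by norm_num))
        (fun h => absurd (congrFun h 2) (by simp; norm_num))
  · intro i j hij s t
    suffices ∑ m, (g i s m - g j t m) ^ 2 = 1 by rw [hφ, this, mul_one]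
    rw [Fin.sum_univ_four]
    revert s t
    fin_cases i <;> fin_cases j <;> first
      | exact absurd hij (by decide)
      | (change ∀ s : Fin 1, ∀ t : Fin 1, _
         intro s t
         simp [g] <;> norm_num)
      | (change ∀ s : Fin 1, ∀ t : Fin 3, _
         intro s t
         fin_cases t <;> simp [g] <;> norm_num)

/-- A rational point of the conic `N x ^ 2 + y ^ 2 = N` off the axis `y = 0`: the second
intersection with the line of slope `-N` through `(1, 0)`. -/
theorem exists_ellipse_point {N : ℚ} (hN : 0 < N) :
    ∃ x y : ℚ, y ≠ 0 ∧ N * x ^ 2 + y ^ 2 = N := by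
  have h : N + 1 ≠ 0 := by positivity
  exact ⟨(N - 1) / (N + 1), 2 * N / (N + 1), by positivity, by field_simp; ring⟩

theorem multipartite_one_three_three_isContained (h : RealizedInRat 5 d) :
    (multipartite ![1, 3, 3]).IsContained (ratGraph 5 d) := by
  obtain ⟨v, hv, hpos⟩ := h.exists_sum_sq
  obtain ⟨φ, hφinj, hφ⟩ := exists_similarity hpos
  generalize ∑ i, v i ^ 2 = r at *
  -- `56 / 81` is the squared length of `(-6/9, -4/9, 2/9)`, which is `1 - (5/9) ^ 2`
  obtain ⟨x, y, hy, hxy⟩ := exists_ellipse_point (show 0 < 56 / 81 * r by positivity)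
  -- `ψ` identifies `ℚ × ℚ^4` with `ℚ^5`, the form becoming `y ^ 2 + r * |x| ^ 2`
  let ψ : ℚ × (Fin 4 → ℚ) → Fin 5 → ℚ := fun p => Fin.cons p.1 (φ p.2)
  have hψinj : Function.Injective ψ := by
    rintro ⟨s, p⟩ ⟨t, q⟩ h
    obtain ⟨h1, h2⟩ := Fin.cons_inj.1 h
    exact Prod.ext h1 (hφinj h2)
  have hψ : ∀ p q, ∑ m, (ψ p m - ψ q m) ^ 2 =
      (p.1 - q.1) ^ 2 + r * ∑ m, (p.2 m - q.2 m) ^ 2 := by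
    intro p q
    simp only [ψ, Fin.sum_univ_succ (n := 4), Fin.cons_zero, Fin.cons_succ, ← hφ]
  -- The last three coordinates of the second part are orthogonal to `(-6, -4, 2)`, to which those of
  -- the third part are proportional; the product of the first coordinates is `1 / 2`.
  let g : ∀ i, Fin (![1, 3, 3] i) → ℚ × (Fin 4 → ℚ) := fun i => match i with
    | 0 => fun _ => (0, ![0, 0, 0, 0])
    | 1 => (![(0, ![9/10, -1/10, 3/10, 3/10]), (0, ![9/10, 1/10, -3/10, -3/10]),
        (0, ![9/10, -1/10, -3/50, -21/50])] : Fin 3 → ℚ × (Fin 4 → ℚ))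
    | 2 => (![(0, ![5/9, -6/9, -4/9, 2/9]), (0, ![5/9, 6/9, 4/9, -2/9]),
        (y, ![5/9, -6/9 * x, -4/9 * x, 2/9 * x])] : Fin 3 → ℚ × (Fin 4 → ℚ))
  refine multipartite_isContained_ratGraph h.1 hv (fun i a => ψ (g i a)) ?_ ?_
  · intro i
    refine hψinj.comp ?_
    fin_cases i
    · exact fun a b _ => Subsingleton.elim (α := Fin 1) a b
    · exact injective_vec_three
        (fun h => absurd (congrFun (congrArg Prod.snd h) 1) (by norm_num))
        (fun h => absurd (congrFun (congrArg Prod.snd h) 2) (by simp; norm_num))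
        (fun h => absurd (congrFun (congrArg Prod.snd h) 1) (by norm_num))
    · exact injective_vec_three
        (fun h => absurd (congrFun (congrArg Prod.snd h) 1) (by norm_num))
        (fun h => hy (congrArg Prod.fst h).symm) (fun h => hy (congrArg Prod.fst h).symm)
  · intro i j hij s t
    rw [hψ, Fin.sum_univ_four]
    revert s t
    fin_cases i <;> fin_cases j <;> first
      | exact absurd hij (by decide)
      | (change ∀ s : Fin 1, ∀ t : Fin 3, _
         intro s t
         fin_cases t <;> simp [g] <;> first | ring1 | linear_combination hxy)
      | (change ∀ s : Fin 3, ∀ t : Fin 3, _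
         intro s t
         fin_cases s <;> fin_cases t <;> simp [g] <;> first | ring1 | linear_combination hxy)

/-! ### Passing to finite subgraphs -/

theorem exists_finite_subgraph {V W X : Type*} [Finite V] {K : SimpleGraph V} {G : SimpleGraph W}
    {G' : SimpleGraph X} (h : K.IsContained G) (h' : ¬ K.IsContained G') :
    ∃ H : G.Subgraph, H.verts.Finite ∧ ¬ H.coe.IsContained G' := by
  obtain ⟨f⟩ := h
  refine ⟨f.toSubgraph, ?_, fun hc => h' (IsContained.trans ⟨f.isoToSubgraph.toCopy⟩ hc)⟩
  exact (Set.toFinite _).image _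

theorem top_isContained_ratGraph_one (h : RealizedInRat 1 d) :
    (⊤ : SimpleGraph (Fin 2)).IsContained (ratGraph 1 d) := by
  obtain ⟨v, hv, hpos⟩ := h.exists_sum_sq
  have hv0 : v ≠ 0 := by rintro rfl; simp at hpos
  refine isContained_ratGraph h.1 hv ![0, v] (injective_vec_two hv0.symm) fun i j hij => ?_
  fin_cases i <;> fin_cases j <;> simp_all

theorem not_top_isContained_unitDistGraph_zero :
    ¬ (⊤ : SimpleGraph (Fin 2)).IsContained (unitDistGraph 0) := by
  rintro ⟨f⟩
  exact absurd (injective_coe_copy f (Subsingleton.elim _ _)) (zero_ne_one (α := Fin 2))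

end EuclideanDistanceGraph

open EuclideanDistanceGraph SimpleGraph in
theorem mainTheorem1 :
    (∀ n : ℕ, 1 ≤ n → n ≤ 5 → ∀ d : ℝ, RealizedInRat n d →
      ∃ H : (ratGraph n d).Subgraph, H.verts.Finite ∧ ¬ H.coe.IsContained (unitDistGraph (n - 1))) ∧
    ((∀ d : ℝ, RealizedInRat 2 d → (cycleGraph 4).IsContained (ratGraph 2 d)) ∧
      ¬ (cycleGraph 4).IsContained (unitDistGraph 1)) ∧
    ((∀ d : ℝ, RealizedInRat 3 d → (multipartite ![2, 3]).IsContained (ratGraph 3 d)) ∧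
      ¬ (multipartite ![2, 3]).IsContained (unitDistGraph 2)) ∧
    ((∀ d : ℝ, RealizedInRat 4 d → (multipartite ![1, 1, 1, 3]).IsContained (ratGraph 4 d)) ∧
      ¬ (multipartite ![1, 1, 1, 3]).IsContained (unitDistGraph 3)) ∧
    ((∀ d : ℝ, RealizedInRat 5 d → (multipartite ![1, 3, 3]).IsContained (ratGraph 5 d)) ∧
      ¬ (multipartite ![1, 3, 3]).IsContained (unitDistGraph 4)) := by
  refine ⟨fun n h1 h5 d hd => ?_,
    ⟨fun _ => cycleGraph_four_isContained, not_cycleGraph_four_isContained⟩,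
    ⟨fun _ => multipartite_two_three_isContained, not_multipartite_two_three_isContained⟩,
    ⟨fun _ => multipartite_one_one_one_three_isContained,
      not_multipartite_one_one_one_three_isContained⟩,
    ⟨fun _ => multipartite_one_three_three_isContained,
      not_multipartite_one_three_three_isContained⟩⟩
  interval_cases n
  · exact exists_finite_subgraph (top_isContained_ratGraph_one hd)
      not_top_isContained_unitDistGraph_zero
  · exact exists_finite_subgraph (cycleGraph_four_isContained hd) not_cycleGraph_four_isContained
  · exact exists_finite_subgraph (multipartite_two_three_isContained hd)
      not_multipartite_two_three_isContained
  · exact exists_finite_subgraph (multipartite_one_one_one_three_isContained hd)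
      not_multipartite_one_one_one_three_isContained
  · exact exists_finite_subgraph (multipartite_one_three_three_isContained hd)
      not_multipartite_one_three_three_isContained
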